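/- Let $\psi=\Gamma'/\Gamma$ be the digamma function, $\gamma$ the Euler–Mascheroni constant, and for real $\tau>0$ and complex $z$ let $$G(z;\tau)=\frac{1}{\tau\,\Gamma(z)}\exp\!\left[\tilde a(\tau)\frac{z}{\tau}+\tilde b(\tau)\frac{z^2}{2\tau^2}\right]\prod_{m=1}^\infty\frac{\Gamma(m\tau)}{\Gamma(z+m\tau)}\exp\!\left[z\psi(m\tau)+\frac{z^2}{2}\psi'(m\tau)\right]$$ be the double gamma function, where $\tilde a(\tau)=a(\tau)-\gamma\tau$, $\tilde b(\tau)=b(\tau)+\frac{\pi^2\tau^2}{6}$, $$a(\tau)=\gamma\tau+\tfrac{\tau}{2}\log(2\pi\tau)+\tfrac12\log\tau-\tau C(\tau),\qquad b(\tau)=-\tfrac{\pi^2\tau^2}{6}-\tau\log\tau-\tau^2D(\tau),$$ $$C(\tau)=\lim_{m\to\infty}\Big[\sum_{k=1}^{m-1}\psi(k\tau)+\tfrac12\psi(m\tau)-\tfrac1\tau\log\tfrac{\Gamma(m\tau)}{\sqrt{2\pi}}\Big],\qquad D(\tau)=\lim_{m\to\infty}\Big[\sum_{k=1}^{m-1}\psi'(k\tau)+\tfrac12\psi'(m\tau)-\tfrac1\tau\psi(m\tau)\Big].$$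 Let $\llbracket a;\tau\rrbracket_n=G(a+n;\tau)/G(a;\tau)$ be the $G$-Pochhammer symbol. For real $\alpha,m>0$, $l>-1/\alpha$ and $z\in\mathbb C$ let $$E_{\alpha,m,l}(z)=\sum_{k=0}^\infty c_kz^k,\qquad c_k=\prod_{j=0}^{k-1}\frac{\Gamma(\alpha(jm+l)+1)}{\Gamma(\alpha(jm+l+1)+1)}$$ be the Kilbas–Saigo function ($c_0=1$). For integers $N\ge1$, $0\le j\le N-1$, $m\ge0$ and real $\alpha$ with $N-1<\alpha\le N$ let $$C^N_{j,m}(\alpha)=\prod_{r=1}^m\frac{\Gamma(1+rN+j-\alpha)}{\Gamma(1+rN+j)},\qquad \varphi^N_{j,\alpha}(x)=\sum_{m=0}^\infty(-1)^mC^N_{j,m}(\alpha)\,x^{mN+j}$$ ($C^N_{j,0}(\alpha)=1$). **Theorem.** (1) Let $N\ge1$ be an integer, $N-1<\alpha\le N$, $0\le j\le N-1$ and $\tau=1/N$. Then for every integer $m\ge0$ $$C^N_{j,m}(\alpha)=\frac{\llbracket 1+(1+j-\alpha)\tau;\tau\rrbracket_m}{\llbracket 1+(1+j)\tau;\tau\rrbracket_m}.$$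 Moreover, for all complex (in particular all real) $\omega,t$ the series defining $\varphi^N_{j,\alpha}(\omega t)$ converges, and $$\varphi^N_{j,\alpha}(\omega t)=(\omega t)^j\sum_{m=0}^\infty\frac{\llbracket 1+(1+j-\alpha)\tau;\tau\rrbracket_m}{\llbracket 1+(1+j)\tau;\tau\rrbracket_m}\left(-(\omega t)^N\right)^m=(\omega t)^j\,E_{\alpha,\frac N\alpha,\frac{N-\alpha+j}{\alpha}}\!\left(-(\omega t)^N\right),$$ where the series in the middle converges. (2) For all real $\alpha,m>0$ and $l>-1/\alpha$ and all $z\in\mathbb C$, the series defining $E_{\alpha,m,l}(z)$ and the following series converge, and $$E_{\alpha,m,l}(z)=\sum_{k=0}^\infty\frac{\llbracket(\alpha l+1)/(\alpha m);1/(\alpha m)\rrbracket_k}{\llbracket(\alpha(l+1)+1)/(\alpha m);1/(\alpha m)\rrbracket_k}\,z^k.$$ -/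

import Mathlib

open Filter Topology

/-- The limit `C(τ)`, for a real parameter `τ > 0`; `ψ` is the digamma function. -/
noncomputable def doubleGammaC (τ : ℝ) : ℂ :=
  limUnder atTop (fun m : ℕ =>
    (∑ k ∈ Finset.Ico 1 m, Complex.digamma ((k * τ : ℝ) : ℂ))
      + (1 / 2) * Complex.digamma ((m * τ : ℝ) : ℂ)
      - (1 / (τ : ℂ)) * (Real.log (Real.Gamma (m * τ) / Real.sqrt (2 * Real.pi)) : ℝ))

/-- The limit `D(τ)`, for a real parameter `τ > 0`; `ψ'` is the derivative of the digamma
function. -/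
noncomputable def doubleGammaD (τ : ℝ) : ℂ :=
  limUnder atTop (fun m : ℕ =>
    (∑ k ∈ Finset.Ico 1 m, deriv Complex.digamma ((k * τ : ℝ) : ℂ))
      + (1 / 2) * deriv Complex.digamma ((m * τ : ℝ) : ℂ)
      - (1 / (τ : ℂ)) * Complex.digamma ((m * τ : ℝ) : ℂ))

/-- `a(τ) = γ τ + (τ / 2) log (2 π τ) + (1 / 2) log τ - τ C(τ)`. -/
noncomputable def doubleGammaA (τ : ℝ) : ℂ :=
  ((Real.eulerMascheroniConstant * τ + τ / 2 * Real.log (2 * Real.pi * τ)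
      + 1 / 2 * Real.log τ : ℝ) : ℂ) - τ * doubleGammaC τ

/-- `b(τ) = - π² τ² / 6 - τ log τ - τ² D(τ)`. -/
noncomputable def doubleGammaB (τ : ℝ) : ℂ :=
  ((-(Real.pi ^ 2 * τ ^ 2 / 6) - τ * Real.log τ : ℝ) : ℂ) - (τ : ℂ) ^ 2 * doubleGammaD τ

/-- `ã(τ) = a(τ) - γ τ`. -/
noncomputable def doubleGammaATilde (τ : ℝ) : ℂ :=
  doubleGammaA τ - ((Real.eulerMascheroniConstant * τ : ℝ) : ℂ)

/-- `b̃(τ) = b(τ) + π² τ² / 6`. -/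
noncomputable def doubleGammaBTilde (τ : ℝ) : ℂ :=
  doubleGammaB τ + ((Real.pi ^ 2 * τ ^ 2 / 6 : ℝ) : ℂ)

/-- The (Barnes) double gamma function `G(z; τ)`, for complex `z` and a real parameter `τ > 0`:
`G(z; τ) = 1 / (τ Γ(z)) * exp (ã(τ) z / τ + b̃(τ) z² / (2 τ²))
  * ∏_{m ≥ 1} Γ(m τ) / Γ(z + m τ) * exp (z ψ(m τ) + (z² / 2) ψ'(m τ))`.
The product index is shifted by one. At a pole `s` of the gamma function `Complex.Gamma s = 0`, so
that `1 / Γ(s)` has its usual value `0` and the formula is right for every complex `z`. -/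
noncomputable def doubleGamma (z : ℂ) (τ : ℝ) : ℂ :=
  1 / ((τ : ℂ) * Complex.Gamma z)
    * Complex.exp (doubleGammaATilde τ * (z / τ) + doubleGammaBTilde τ * (z ^ 2 / (2 * (τ : ℂ) ^ 2)))
    * ∏' n : ℕ,
        (Complex.Gamma (((n + 1 : ℕ) * τ : ℝ) : ℂ) / Complex.Gamma (z + (((n + 1 : ℕ) * τ : ℝ) : ℂ))
          * Complex.exp (z * Complex.digamma (((n + 1 : ℕ) * τ : ℝ) : ℂ)
              + z ^ 2 / 2 * deriv Complex.digamma (((n + 1 : ℕ) * τ : ℝ) : ℂ)))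

/-- The `G`-Pochhammer symbol `⟦a; τ⟧_n = G(a + n; τ) / G(a; τ)`. -/
noncomputable def gPochhammer (a : ℂ) (τ : ℝ) (n : ℕ) : ℂ :=
  doubleGamma (a + n) τ / doubleGamma a τ

/-- The Taylor coefficients of the Kilbas–Saigo function:
`c_k = ∏_{j = 0}^{k - 1} Γ(α (j m + l) + 1) / Γ(α (j m + l + 1) + 1)`, with `c_0 = 1`. -/
noncomputable def kilbasSaigoCoeff (α m l : ℝ) (k : ℕ) : ℝ :=
  ∏ j ∈ Finset.range k,
    Real.Gamma (α * (j * m + l) + 1) / Real.Gamma (α * (j * m + l + 1) + 1)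

/-- The Kilbas–Saigo function `E_{α,m,l}(z) = ∑_{k ≥ 0} c_k z^k`. -/
noncomputable def kilbasSaigo (α m l : ℝ) (z : ℂ) : ℂ :=
  ∑' k : ℕ, (kilbasSaigoCoeff α m l k : ℂ) * z ^ k

/-- The Rule I coefficients
`C^N_{j,m}(α) = ∏_{r = 1}^{m} Γ(1 + r N + j - α) / Γ(1 + r N + j)`, with `C^N_{j,0}(α) = 1`. -/
noncomputable def ruleOneCoeff (N j : ℕ) (α : ℝ) (m : ℕ) : ℝ :=
  ∏ r ∈ Finset.Icc 1 m, Real.Gamma (1 + r * N + j - α) / Real.Gamma (1 + r * N + j)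

/-- The Rule I functions `φ^N_{j,α}(x) = ∑_{m ≥ 0} (-1)^m C^N_{j,m}(α) x^{m N + j}`. -/
noncomputable def ruleOnePhi (N j : ℕ) (α : ℝ) (x : ℂ) : ℂ :=
  ∑' m : ℕ, (-1) ^ m * (ruleOneCoeff N j α m : ℂ) * x ^ (m * N + j)

/-! Everything rests on the quasi-periodicity `G(z + 1; τ) = c Γ(z / τ) G(z; τ)` with `c ≠ 0`
depending only on `τ`. Iterating it turns each `G`-Pochhammer symbol into `c ^ n` times a product of
gamma values, and `c ^ n` cancels in a quotient of two symbols. The exact value of `c` is therefore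
irrelevant and the limit `C(τ)` is never evaluated. Only `D(τ)` is needed, since the quadratic
exponent contributes a term linear in `z` under the shift.

All parameters are positive reals, so it suffices to treat `z > 0`. There the logarithm of the
infinite product is minus a sum of second-order Taylor remainders of `log Γ` at `nτ`, which are `O(1
/ n²)`. Under `z ↦ z + 1` the sum changes by terms `log (nτ + z)`, which form the Bohr–Mollerup
sequence for `log Γ(z / τ)`, by a multiple of `z`, and by a constant
(`exists_tsum_logGammaTaylorRemainder_add_one`).

Convergence of the power series is the ratio test, with `Γ(y) / Γ(y + α) → 0`. -/

namespace Real

/-! ### Digamma and trigamma on the positive reals -/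

/-- The digamma function on the real line, as the derivative of `log Γ`. -/
noncomputable def realDigamma (x : ℝ) : ℝ := deriv (fun y => log (Gamma y)) x

/-- The trigamma function on the positive real line, as a series. -/
noncomputable def trigamma (x : ℝ) : ℝ := ∑' k : ℕ, 1 / (x + k) ^ 2

theorem differentiableAt_Gamma_of_pos {x : ℝ} (hx : 0 < x) : DifferentiableAt ℝ Gamma x :=
  differentiableAt_Gamma fun m => by
    have : (0 : ℝ) ≤ m := m.cast_nonneg
    linarith

theorem hasDerivAt_log_Gamma {x : ℝ} (hx : 0 < x) :
    HasDerivAt (fun y => log (Gamma y)) (realDigamma x) x :=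
  ((differentiableAt_Gamma_of_pos hx).log (Gamma_pos_of_pos hx).ne').hasDerivAt

theorem log_Gamma_add_one {x : ℝ} (hx : 0 < x) :
    log (Gamma (x + 1)) = log (Gamma x) + log x := by
  rw [Gamma_add_one hx.ne', log_mul hx.ne' (Gamma_pos_of_pos hx).ne', add_comm]

theorem realDigamma_add_one {x : ℝ} (hx : 0 < x) :
    realDigamma (x + 1) = realDigamma x + 1 / x := by
  have h1 : HasDerivAt (fun y => log (Gamma (y + 1))) (realDigamma (x + 1)) x :=
    (hasDerivAt_log_Gamma (by linarith : 0 < x + 1)).comp_add_const x 1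
  have h2 := (hasDerivAt_log_Gamma hx).add (hasDerivAt_log hx.ne')
  rw [one_div]
  refine h1.unique (h2.congr_of_eventuallyEq ?_)
  filter_upwards [eventually_gt_nhds hx] with y hy using log_Gamma_add_one hy

theorem realDigamma_add_nat {x : ℝ} (hx : 0 < x) (n : ℕ) :
    realDigamma (x + n) = realDigamma x + ∑ k ∈ Finset.range n, 1 / (x + k) := by
  induction n with
  | zero => simp
  | succ n ih =>
    rw [Finset.sum_range_succ, ← add_assoc, ← ih, ← realDigamma_add_one (by positivity)]
    push_cast
    rw [add_assoc]

/-- `log Γ` is convex and its slope over `[x, x + 1]` is `log x`, which therefore lies between the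
derivatives at the two endpoints. -/
theorem realDigamma_le_log {x : ℝ} (hx : 0 < x) : realDigamma x ≤ log x := by
  have h := convexOn_log_Gamma.le_slope_of_hasDerivAt (x := x) (y := x + 1) hx
    (show (0 : ℝ) < x + 1 by linarith) (by linarith) (hasDerivAt_log_Gamma hx)
  rw [slope_def_field] at h
  simpa [log_Gamma_add_one hx] using h

theorem log_sub_one_div_le_realDigamma {x : ℝ} (hx : 0 < x) : log x - 1 / x ≤ realDigamma x := by
  have h := convexOn_log_Gamma.slope_le_of_hasDerivAt (x := x) (y := x + 1) hx
    (show (0 : ℝ) < x + 1 by linarith) (by linarith) (hasDerivAt_log_Gamma (by linarith))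
  rw [slope_def_field, realDigamma_add_one hx] at h
  simp only [Function.comp_apply, log_Gamma_add_one hx, add_sub_cancel_left, div_one] at h
  linarith

theorem tendsto_realDigamma_sub_log :
    Tendsto (fun x => realDigamma x - log x) atTop (𝓝 0) := by
  have h : Tendsto (fun x : ℝ => -(1 / x)) atTop (𝓝 0) := by
    simpa using (tendsto_inv_atTop_zero (𝕜 := ℝ)).neg
  refine tendsto_of_tendsto_of_tendsto_of_le_of_le' h tendsto_const_nhds ?_ ?_
  · filter_upwards [eventually_gt_atTop 0] with x hx
    linarith [log_sub_one_div_le_realDigamma hx]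
  · filter_upwards [eventually_gt_atTop 0] with x hx
    linarith [realDigamma_le_log hx]

theorem tendsto_realDigamma_atTop : Tendsto realDigamma atTop atTop := by
  have h := tendsto_realDigamma_sub_log.add_atTop tendsto_log_atTop
  simpa using h

theorem tendsto_realDigamma_add_nat_sub {x y : ℝ} (hx : 0 < x) (hy : 0 < y) :
    Tendsto (fun n : ℕ => realDigamma (y + n) - realDigamma (x + n)) atTop (𝓝 0) := by
  have hlim (c : ℝ) : Tendsto (fun n : ℕ => c + (n : ℝ)) atTop atTop :=
    tendsto_atTop_add_const_left _ _ tendsto_natCast_atTop_atTop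
  have hlog : Tendsto (fun n : ℕ => log (y + n) - log (x + n)) atTop (𝓝 0) := by
    have h1 : Tendsto (fun n : ℕ => 1 + (y - x) * (x + n)⁻¹) atTop (𝓝 1) := by
      simpa using ((tendsto_inv_atTop_zero.comp (hlim x)).const_mul (y - x)).const_add 1
    have h2 := h1.log one_ne_zero
    rw [log_one] at h2
    refine h2.congr fun n => ?_
    have hxn : 0 < x + n := by positivity
    have hyn : 0 < y + n := by positivity
    rw [← log_div hyn.ne' hxn.ne']
    congr 1
    field_simp
    ring
  have h := ((tendsto_realDigamma_sub_log.comp (hlim y)).sub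
    (tendsto_realDigamma_sub_log.comp (hlim x))).add hlog
  simp only [sub_zero, add_zero] at h
  refine h.congr fun n => ?_
  simp only [Function.comp_apply]
  ring

theorem summable_one_div_add_nat_sq {x : ℝ} (hx : 0 < x) :
    Summable fun k : ℕ => 1 / (x + k) ^ 2 := by
  refine (summable_nat_add_iff 1).mp (Summable.of_nonneg_of_le (fun k => by positivity) (fun k => ?_)
    ((summable_nat_add_iff 1).mpr (Real.summable_one_div_nat_pow.mpr one_lt_two)))
  gcongr
  linarith

/-- Telescoping the recursion gives `ψ(y) - ψ(x) = ∑ (1 / (x + k) - 1 / (y + k))`, because the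
difference of the shifted values tends to `0`. The series is differentiated termwise on `(x / 2,
∞)`, where the derivatives have a uniform summable bound. -/
theorem hasDerivAt_realDigamma {x : ℝ} (hx : 0 < x) :
    HasDerivAt realDigamma (trigamma x) x := by
  have hx2 : 0 < x / 2 := by positivity
  have hmem : x ∈ Set.Ioi (x / 2) := by
    rw [Set.mem_Ioi]
    linarith
  have hder (n : ℕ) (y : ℝ) (hy : y ∈ Set.Ioi (x / 2)) :
      HasDerivAt (fun y => 1 / (x + n) - 1 / (y + n)) (1 / (y + n) ^ 2) y := by
    have hy0 : 0 < y := hx2.trans hy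
    have hyn : 0 < y + n := by positivity
    have h := (((hasDerivAt_id y).add_const (n : ℝ)).inv hyn.ne').const_sub (1 / (x + n))
    simp only [id_eq] at h
    refine (h.congr_deriv (by ring)).congr_of_eventuallyEq (.of_forall fun z => ?_)
    simp [one_div]
  have hbound (n : ℕ) (y : ℝ) (hy : y ∈ Set.Ioi (x / 2)) :
      ‖1 / (y + n) ^ 2‖ ≤ 1 / (x / 2 + n) ^ 2 := by
    have hy' : x / 2 < y := hy
    have hy0 : 0 < y := hx2.trans hy'
    rw [norm_of_nonneg (by positivity)]
    gcongr
  have hsum0 : Summable fun n : ℕ => 1 / (x + n) - 1 / (x + n) := by simp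
  have hu := summable_one_div_add_nat_sq hx2
  have hF := hasDerivAt_tsum_of_isPreconnected hu isOpen_Ioi isPreconnected_Ioi hder hbound
    hmem hsum0 hmem
  refine (hF.const_add (realDigamma x)).congr_of_eventuallyEq ?_
  filter_upwards [eventually_gt_nhds (by linarith : x / 2 < x)] with y hy
  have hy0 : 0 < y := hx2.trans hy
  have hs := (summable_of_summable_hasDerivAt_of_isPreconnected hu isOpen_Ioi isPreconnected_Ioi
    hder hbound hmem hsum0 (Set.mem_Ioi.mpr hy)).hasSum.tendsto_sum_nat
  have ht : Tendsto (fun n : ℕ => ∑ k ∈ Finset.range n, (1 / (x + k) - 1 / (y + k))) atTop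
      (𝓝 (realDigamma y - realDigamma x)) := by
    have h := (tendsto_realDigamma_add_nat_sub hy0 hx).add_const (realDigamma y - realDigamma x)
    rw [zero_add] at h
    refine h.congr fun n => ?_
    rw [Finset.sum_sub_distrib, realDigamma_add_nat hy0, realDigamma_add_nat hx]
    ring
  rw [tendsto_nhds_unique hs ht]
  ring

theorem trigamma_anti {x y : ℝ} (hx : 0 < x) (hxy : x ≤ y) : trigamma y ≤ trigamma x := by
  refine (summable_one_div_add_nat_sq (hx.trans_le hxy)).tsum_le_tsum (fun k => ?_)
    (summable_one_div_add_nat_sq hx)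
  gcongr

theorem trigamma_add_one {x : ℝ} (hx : 0 < x) : trigamma x = 1 / x ^ 2 + trigamma (x + 1) := by
  rw [trigamma, (summable_one_div_add_nat_sq hx).tsum_eq_zero_add]
  simp only [Nat.cast_zero, add_zero, trigamma]
  congr 2
  ext k
  push_cast
  ring

theorem exists_realDigamma_sub_eq {x y : ℝ} (hx : 0 < x) (hxy : x < y) :
    ∃ c ∈ Set.Ioo x y, realDigamma y - realDigamma x = (y - x) * trigamma c := by
  obtain ⟨c, hc, h⟩ := exists_hasDerivAt_eq_slope realDigamma trigamma hxy
    (fun z hz => (hasDerivAt_realDigamma (hx.trans_le hz.1)).continuousAt.continuousWithinAt)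
    (fun z hz => hasDerivAt_realDigamma (hx.trans hz.1))
  refine ⟨c, hc, ?_⟩
  rw [h, mul_div_cancel₀ _ (sub_pos.mpr hxy).ne']

/-- By the mean value theorem `1 / x = ψ(x + 1) - ψ(x)` is a value of `ψ'` on `(x, x + 1)`, and `ψ'`
is decreasing. -/
theorem one_div_le_trigamma {x : ℝ} (hx : 0 < x) : 1 / x ≤ trigamma x := by
  obtain ⟨c, hc, h⟩ := exists_realDigamma_sub_eq hx (lt_add_one x)
  rw [realDigamma_add_one hx] at h
  have := trigamma_anti hx hc.1.le
  linarith

theorem trigamma_le {x : ℝ} (hx : 0 < x) : trigamma x ≤ 1 / x + 1 / x ^ 2 := by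
  obtain ⟨c, hc, h⟩ := exists_realDigamma_sub_eq hx (lt_add_one x)
  rw [realDigamma_add_one hx] at h
  have := trigamma_anti (hx.trans hc.1) hc.2.le
  rw [trigamma_add_one hx]
  linarith

theorem trigamma_sub_trigamma_add_le {x s : ℝ} (hx : 0 < x) (hs : 0 ≤ s) :
    trigamma x - trigamma (x + s) ≤ (s + 1) / x ^ 2 := by
  have h1 := trigamma_le hx
  have h2 := one_div_le_trigamma (by linarith : 0 < x + s)
  have h3 : 1 / x - 1 / (x + s) ≤ s / x ^ 2 := by
    rw [div_sub_div _ _ hx.ne' (by positivity), div_le_div_iff₀ (by positivity) (by positivity)]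
    nlinarith [mul_nonneg (mul_nonneg hs hs) hx.le]
  rw [add_div]
  linarith

/-! ### Taylor remainder of `log Γ` -/

/-- The remainder of order two in the Taylor expansion of `log Γ` at `x`. -/
noncomputable def logGammaTaylorRemainder (x z : ℝ) : ℝ :=
  log (Gamma (x + z)) - log (Gamma x) - z * realDigamma x - z ^ 2 / 2 * trigamma x

/-- Two applications of the mean value theorem give the remainder as `-z s (ψ'(x) - ψ'(c))` with `0
< s < z` and `x < c < x + s`; the oscillation of `ψ'` is `O(1 / x²)`. -/
theorem abs_logGammaTaylorRemainder_le {x z : ℝ} (hx : 0 < x) (hz : 0 < z) :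
    |logGammaTaylorRemainder x z| ≤ (z + 1) * z ^ 2 * (1 / x ^ 2) := by
  have hder (s : ℝ) (hs : 0 ≤ s) : HasDerivAt (logGammaTaylorRemainder x)
      (realDigamma (x + s) - realDigamma x - s * trigamma x) s := by
    have h1 : HasDerivAt (fun s => log (Gamma (x + s))) (realDigamma (x + s)) s :=
      (hasDerivAt_log_Gamma (by linarith : 0 < x + s)).comp_const_add x s
    have h2 := ((h1.sub_const (log (Gamma x))).sub
      ((hasDerivAt_id s).mul_const (realDigamma x))).sub
      ((((hasDerivAt_id s).pow 2).div_const 2).mul_const (trigamma x))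
    refine h2.congr_deriv ?_
    simp
  obtain ⟨s, hs, h⟩ := exists_hasDerivAt_eq_slope (logGammaTaylorRemainder x) _ hz
    (fun s hs => (hder s hs.1).continuousAt.continuousWithinAt) (fun s hs => hder s hs.1.le)
  obtain ⟨c, hc, h'⟩ := exists_realDigamma_sub_eq hx (lt_add_of_pos_right x hs.1)
  have h0 : logGammaTaylorRemainder x 0 = 0 := by simp [logGammaTaylorRemainder]
  rw [h0, sub_zero, sub_zero, eq_div_iff hz.ne', h'] at h
  have hanti := trigamma_anti hx hc.1.le
  have hlow := trigamma_sub_trigamma_add_le hx (sub_nonneg.mpr hc.1.le)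
  rw [add_sub_cancel] at hlow
  have hcz : (c - x + 1) / x ^ 2 ≤ (z + 1) / x ^ 2 := by
    have := hc.2
    have := hs.2
    gcongr
    linarith
  have hsz : s * (trigamma x - trigamma c) ≤ z * ((z + 1) / x ^ 2) :=
    mul_le_mul hs.2.le (hlow.trans hcz) (sub_nonneg.mpr hanti) hz.le
  have heq : -logGammaTaylorRemainder x z = s * (trigamma x - trigamma c) * z := by
    rw [← h]
    ring
  rw [← abs_neg, heq, abs_of_nonneg
    (mul_nonneg (mul_nonneg hs.1.le (sub_nonneg.mpr hanti)) hz.le)]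
  calc s * (trigamma x - trigamma c) * z ≤ z * ((z + 1) / x ^ 2) * z := by gcongr
    _ = (z + 1) * z ^ 2 * (1 / x ^ 2) := by ring

end Real

/-! ### Complex digamma at positive real points -/

namespace Complex

theorem differentiableAt_Gamma_of_re_pos {z : ℂ} (hz : 0 < z.re) :
    DifferentiableAt ℂ Gamma z :=
  differentiableAt_Gamma z fun m h => by
    have h' := congrArg re h
    have : (0 : ℝ) ≤ m := m.cast_nonneg
    simp only [neg_re, natCast_re] at h'
    linarith

theorem digamma_ofReal {x : ℝ} (hx : 0 < x) : digamma (x : ℂ) = (Real.realDigamma x : ℂ) := by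
  have h1 := (differentiableAt_Gamma_of_re_pos (z := x) (by simpa)).hasDerivAt.comp_ofReal
  have h2 := (Real.differentiableAt_Gamma_of_pos hx).hasDerivAt.ofReal_comp
  have h3 : deriv Gamma (x : ℂ) = ((deriv Real.Gamma x : ℝ) : ℂ) := by
    exact h1.unique (h2.congr_of_eventuallyEq (.of_forall Gamma_ofReal))
  rw [digamma_def, logDeriv_apply, h3, Gamma_ofReal, Real.realDigamma,
    deriv.log (Real.differentiableAt_Gamma_of_pos hx) (Real.Gamma_pos_of_pos hx).ne', ofReal_div]

theorem deriv_digamma_ofReal {x : ℝ} (hx : 0 < x) :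
    deriv digamma (x : ℂ) = (Real.trigamma x : ℂ) := by
  have hopen : IsOpen {z : ℂ | 0 < z.re} := isOpen_lt continuous_const continuous_re
  have hmem : (x : ℂ) ∈ {z : ℂ | 0 < z.re} := by simpa
  have hG : DifferentiableOn ℂ Gamma {z : ℂ | 0 < z.re} := fun z hz =>
    (differentiableAt_Gamma_of_re_pos hz).differentiableWithinAt
  have hd : DifferentiableAt ℂ digamma (x : ℂ) :=
    ((hG.deriv hopen).differentiableAt (hopen.mem_nhds hmem)).div
      (hG.differentiableAt (hopen.mem_nhds hmem)) (Gamma_ne_zero_of_re_pos hmem)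
  refine hd.hasDerivAt.comp_ofReal.unique
    ((Real.hasDerivAt_realDigamma hx).ofReal_comp.congr_of_eventuallyEq ?_)
  filter_upwards [eventually_gt_nhds hx] with y hy using digamma_ofReal hy

end Complex

/-! ### The double gamma function at positive real points -/

namespace Real

theorem tendsto_trigamma_atTop : Tendsto trigamma atTop (𝓝 0) := by
  have h : Tendsto (fun x : ℝ => 1 / x + 1 / x ^ 2) atTop (𝓝 0) := by
    have h1 : Tendsto (fun x : ℝ => x⁻¹) atTop (𝓝 0) := tendsto_inv_atTop_zero
    simpa using h1.add (h1.pow 2)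
  refine tendsto_of_tendsto_of_tendsto_of_le_of_le' tendsto_const_nhds h ?_ ?_
  · filter_upwards [eventually_gt_atTop 0] with x hx
    exact (by positivity : 0 ≤ 1 / x).trans (one_div_le_trigamma hx)
  · filter_upwards [eventually_gt_atTop 0] with x hx using trigamma_le hx

theorem summable_one_div_succ_mul_sq (τ : ℝ) :
    Summable fun n : ℕ => 1 / (((n + 1 : ℕ) : ℝ) * τ) ^ 2 := by
  have h := ((summable_nat_add_iff 1).mpr
    (Real.summable_one_div_nat_pow.mpr one_lt_two)).mul_right (1 / τ ^ 2)
  refine h.congr fun n => ?_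
  rw [mul_pow, div_mul_div_comm, one_mul]

/-- Existence of the limit `lim (∑_{n = 1}^{M} ψ'(n τ) - log M / τ)`. -/
theorem exists_tendsto_sum_trigamma_sub_log {τ : ℝ} (hτ : 0 < τ) :
    ∃ L : ℝ, Tendsto (fun M : ℕ => ∑ n ∈ Finset.range M, trigamma ((n + 1 : ℕ) * τ) - log M / τ)
      atTop (𝓝 L) := by
  -- Since `0 ≤ ψ'(x) - 1 / x ≤ 1 / x²`, the sum is compared with the harmonic numbers divided by
  -- `τ`.
  have hs : Summable fun n : ℕ => trigamma ((n + 1 : ℕ) * τ) - 1 / ((n + 1 : ℕ) * τ) := by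
    refine Summable.of_nonneg_of_le (fun n => ?_) (fun n => ?_) (summable_one_div_succ_mul_sq τ)
    · exact sub_nonneg.mpr (one_div_le_trigamma (by positivity))
    · linarith [trigamma_le (by positivity : 0 < ((n + 1 : ℕ) : ℝ) * τ)]
  refine ⟨_, (hs.hasSum.tendsto_sum_nat.add (tendsto_harmonic_sub_log.div_const τ)).congr
    fun M => ?_⟩
  rw [Finset.sum_sub_distrib, harmonic]
  push_cast
  rw [sub_div, Finset.sum_div]
  have : ∑ n ∈ Finset.range M, 1 / (((n : ℝ) + 1) * τ) =
      ∑ n ∈ Finset.range M, ((n : ℝ) + 1)⁻¹ / τ :=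
    Finset.sum_congr rfl fun n _ => by rw [one_div, mul_inv, div_eq_mul_inv]
  rw [this]
  ring

theorem tendsto_natCast_mul_atTop {τ : ℝ} (hτ : 0 < τ) :
    Tendsto (fun M : ℕ => (M : ℝ) * τ) atTop atTop :=
  tendsto_natCast_atTop_atTop.atTop_mul_const hτ

/-- The halved last term is harmless because `ψ' → 0`, and `ψ(Mτ)` may be replaced by `log M + log
τ`. -/
theorem doubleGammaD_eq {τ L : ℝ} (hτ : 0 < τ)
    (hL : Tendsto (fun M : ℕ => ∑ n ∈ Finset.range M, trigamma ((n + 1 : ℕ) * τ) - log M / τ)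
      atTop (𝓝 L)) :
    doubleGammaD τ = ((L - log τ / τ : ℝ) : ℂ) := by
  have h1 := tendsto_trigamma_atTop.comp (tendsto_natCast_mul_atTop hτ)
  have h2 := tendsto_realDigamma_sub_log.comp (tendsto_natCast_mul_atTop hτ)
  have h3 := ((hL.sub (h1.const_mul (1 / 2))).sub (h2.const_mul (1 / τ))).sub_const (log τ / τ)
  simp only [mul_zero, sub_zero] at h3
  refine Tendsto.limUnder_eq (((Complex.continuous_ofReal.tendsto _).comp h3).congr' ?_)
  filter_upwards [eventually_gt_atTop 0] with M hM
  obtain ⟨M, rfl⟩ := Nat.exists_eq_add_one.mpr hM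
  have hMτ : 0 < ((M + 1 : ℕ) : ℝ) * τ := by positivity
  rw [Complex.deriv_digamma_ofReal hMτ, Complex.digamma_ofReal hMτ,
    Finset.sum_Ico_eq_sum_range, Nat.add_sub_cancel]
  have hsum : ∑ k ∈ Finset.range M, deriv Complex.digamma ((((1 + k : ℕ) : ℝ) * τ : ℝ) : ℂ) =
      ∑ k ∈ Finset.range M, (trigamma (((k + 1 : ℕ) : ℝ) * τ) : ℂ) :=
    Finset.sum_congr rfl fun k _ => by
      rw [add_comm 1 k, Complex.deriv_digamma_ofReal (by positivity)]
  rw [hsum]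
  simp only [Function.comp_apply, Finset.sum_range_succ]
  rw [log_mul (by positivity) hτ.ne']
  push_cast
  ring

/-- The `π²` terms and the `τ log τ` terms cancel, so only `L` survives. -/
theorem doubleGammaBTilde_eq {τ L : ℝ} (hτ : 0 < τ)
    (hL : Tendsto (fun M : ℕ => ∑ n ∈ Finset.range M, trigamma ((n + 1 : ℕ) * τ) - log M / τ)
      atTop (𝓝 L)) :
    doubleGammaBTilde τ = ((-(τ ^ 2 * L) : ℝ) : ℂ) := by
  have hτ' : (τ : ℂ) ≠ 0 := by exact_mod_cast hτ.ne'
  rw [doubleGammaBTilde, doubleGammaB, doubleGammaD_eq hτ hL]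
  push_cast
  field_simp
  ring

theorem summable_logGammaTaylorRemainder {τ z : ℝ} (hτ : 0 < τ) (hz : 0 < z) :
    Summable fun n : ℕ => logGammaTaylorRemainder ((n + 1 : ℕ) * τ) z :=
  Summable.of_norm_bounded ((summable_one_div_succ_mul_sq τ).mul_left ((z + 1) * z ^ 2))
    fun n => abs_logGammaTaylorRemainder_le (by positivity) hz

theorem doubleGamma_factor_eq {x z : ℝ} (hx : 0 < x) (hz : 0 < z) :
    Complex.Gamma (x : ℂ) / Complex.Gamma (z + (x : ℂ)) *
      Complex.exp (z * Complex.digamma (x : ℂ) + z ^ 2 / 2 * deriv Complex.digamma (x : ℂ)) =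
    Complex.exp ((-logGammaTaylorRemainder x z : ℝ) : ℂ) := by
  have hxz : 0 < x + z := by positivity
  rw [Complex.digamma_ofReal hx, Complex.deriv_digamma_ofReal hx, ← Complex.ofReal_add, add_comm z x,
    Complex.Gamma_ofReal, Complex.Gamma_ofReal, ← Complex.ofReal_exp]
  have : exp (-logGammaTaylorRemainder x z) = Gamma x / Gamma (x + z) *
      exp (z * realDigamma x + z ^ 2 / 2 * trigamma x) := by
    rw [logGammaTaylorRemainder, ← exp_log (Gamma_pos_of_pos hx), ← exp_log (Gamma_pos_of_pos hxz),
      ← exp_sub, ← exp_add, log_exp, log_exp]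
    congr 1
    ring
  rw [this]
  push_cast
  ring

/-- For `z > 0` the double gamma function is given by a convergent series in the exponent. -/
theorem doubleGamma_ofReal {τ z : ℝ} (hτ : 0 < τ) (hz : 0 < z) :
    doubleGamma (z : ℂ) τ = 1 / ((τ : ℂ) * (Gamma z : ℂ)) *
      Complex.exp (doubleGammaATilde τ * (z / τ) +
        doubleGammaBTilde τ * ((z : ℂ) ^ 2 / (2 * (τ : ℂ) ^ 2))) *
      Complex.exp ((-∑' n : ℕ, logGammaTaylorRemainder ((n + 1 : ℕ) * τ) z : ℝ) : ℂ) := by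
  have hsum : HasSum (fun n : ℕ => ((-logGammaTaylorRemainder ((n + 1 : ℕ) * τ) z : ℝ) : ℂ))
      ((-∑' n : ℕ, logGammaTaylorRemainder ((n + 1 : ℕ) * τ) z : ℝ) : ℂ) :=
    Complex.hasSum_ofReal.mpr (summable_logGammaTaylorRemainder hτ hz).hasSum.neg
  rw [doubleGamma, Complex.Gamma_ofReal, ← hsum.cexp.tprod_eq]
  congr 1
  refine tprod_congr fun n => ?_
  exact doubleGamma_factor_eq (by positivity) hz

theorem doubleGamma_ofReal_ne_zero {τ z : ℝ} (hτ : 0 < τ) (hz : 0 < z) :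
    doubleGamma (z : ℂ) τ ≠ 0 := by
  rw [doubleGamma_ofReal hτ hz]
  have h1 : (τ : ℂ) ≠ 0 := by exact_mod_cast hτ.ne'
  have h2 : (Gamma z : ℂ) ≠ 0 := by exact_mod_cast (Gamma_pos_of_pos hz).ne'
  exact mul_ne_zero (mul_ne_zero (one_div_ne_zero (mul_ne_zero h1 h2)) (Complex.exp_ne_zero _))
    (Complex.exp_ne_zero _)

/-! ### Quasi-periodicity and `G`-Pochhammer quotients -/

theorem logGammaTaylorRemainder_add_one_sub {x z : ℝ} (hx : 0 < x) (hz : 0 < z) :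
    logGammaTaylorRemainder x (z + 1) - logGammaTaylorRemainder x z =
      log (x + z) - realDigamma x - (z + 1 / 2) * trigamma x := by
  simp only [logGammaTaylorRemainder]
  rw [← add_assoc, log_Gamma_add_one (by positivity)]
  ring

/-- The quasi-periodicity of the exponent, in logarithmic form. -/
theorem exists_tsum_logGammaTaylorRemainder_add_one {τ L : ℝ} (hτ : 0 < τ)
    (hL : Tendsto (fun M : ℕ => ∑ n ∈ Finset.range M, trigamma ((n + 1 : ℕ) * τ) - log M / τ)
      atTop (𝓝 L)) :
    ∃ K : ℝ, ∀ z : ℝ, 0 < z →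
      ∑' n : ℕ, logGammaTaylorRemainder ((n + 1 : ℕ) * τ) (z + 1) =
        ∑' n : ℕ, logGammaTaylorRemainder ((n + 1 : ℕ) * τ) z +
          (K - z * L - log (Gamma (z / τ)) - log z) := by
  -- The sequence does not involve `z`, so neither can its limit. The term `(z / τ) log M` of the
  -- Bohr–Mollerup sequence cancels against the `log M / τ` in `hL`.
  have key (z : ℝ) (hz : 0 < z) : Tendsto (fun M : ℕ => (M + 1) * log τ + log (M.factorial : ℝ) -
      ∑ n ∈ Finset.range M,
        (realDigamma ((n + 1 : ℕ) * τ) + 1 / 2 * trigamma ((n + 1 : ℕ) * τ))) atTop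
      (𝓝 (log z + (∑' n : ℕ, logGammaTaylorRemainder ((n + 1 : ℕ) * τ) (z + 1) -
        ∑' n : ℕ, logGammaTaylorRemainder ((n + 1 : ℕ) * τ) z) + z * L +
          log (Gamma (z / τ)))) := by
    have h1 := ((summable_logGammaTaylorRemainder hτ (by linarith : 0 < z + 1)).hasSum.sub
      (summable_logGammaTaylorRemainder hτ hz).hasSum).tendsto_sum_nat
    have h2 := BohrMollerup.tendsto_log_gamma (div_pos hz hτ)
    refine (((h1.const_add (log z)).add (hL.const_mul z)).add h2).congr fun M => ?_
    have hlog (n : ℕ) : log (z / τ + n) = log (n * τ + z) - log τ := by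
      rw [← log_div (by positivity) hτ.ne']
      congr 1
      field_simp
      ring
    -- The Bohr–Mollerup sum has `M + 1` terms; its term of index `0` produces the separate `log z`.
    have hsum : ∑ m ∈ Finset.range (M + 1), log (z / τ + m) =
        ∑ n ∈ Finset.range M, log ((n + 1 : ℕ) * τ + z) + log z - (M + 1) * log τ := by
      simp_rw [hlog]
      rw [Finset.sum_sub_distrib, Finset.sum_range_succ']
      simp
    have hdiff : ∑ n ∈ Finset.range M, (logGammaTaylorRemainder ((n + 1 : ℕ) * τ) (z + 1) -
          logGammaTaylorRemainder ((n + 1 : ℕ) * τ) z) =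
        ∑ n ∈ Finset.range M, log ((n + 1 : ℕ) * τ + z) -
          ∑ n ∈ Finset.range M,
            (realDigamma ((n + 1 : ℕ) * τ) + 1 / 2 * trigamma ((n + 1 : ℕ) * τ)) -
          z * ∑ n ∈ Finset.range M, trigamma ((n + 1 : ℕ) * τ) := by
      rw [Finset.mul_sum, ← Finset.sum_sub_distrib, ← Finset.sum_sub_distrib]
      refine Finset.sum_congr rfl fun n _ => ?_
      rw [logGammaTaylorRemainder_add_one_sub (by positivity) hz]
      ring
    rw [BohrMollerup.logGammaSeq, hsum, hdiff]
    ring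
  -- The choice `z = 1` only serves to name the common limit.
  obtain ⟨K, hK⟩ : ∃ K : ℝ, Tendsto _ atTop (𝓝 K) := ⟨_, key 1 one_pos⟩
  refine ⟨K, fun z hz => ?_⟩
  rw [← tendsto_nhds_unique (key z hz) hK]
  ring

/-- Up to a constant factor, which only depends on `τ`, the double gamma function satisfies
`G(z + 1; τ) = Γ(z / τ) G(z; τ)`. -/
theorem exists_doubleGamma_add_one {τ : ℝ} (hτ : 0 < τ) :
    ∃ c : ℂ, c ≠ 0 ∧ ∀ z : ℝ, 0 < z →
      doubleGamma ((z : ℂ) + 1) τ = c * (Gamma (z / τ) : ℂ) * doubleGamma (z : ℂ) τ := by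
  obtain ⟨L, hL⟩ := exists_tendsto_sum_trigamma_sub_log hτ
  obtain ⟨K, hK⟩ := exists_tsum_logGammaTaylorRemainder_add_one hτ hL
  -- Here `ã / τ` comes from the linear exponent and `-L / 2` from `(z + 1)² - z² = 2z + 1`, whose
  -- part `-zL` cancels the `zL` in the remainder sum. The leftover `log z` absorbs the factor in
  -- `Γ(z + 1) = z Γ(z)`.
  refine ⟨Complex.exp (doubleGammaATilde τ / τ + ((-(L / 2) - K : ℝ) : ℂ)), Complex.exp_ne_zero _,
    fun z hz => ?_⟩
  have h1 : (τ : ℂ) ≠ 0 := by exact_mod_cast hτ.ne'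
  have h2 : (Gamma z : ℂ) ≠ 0 := by exact_mod_cast (Gamma_pos_of_pos hz).ne'
  have h3 : (z : ℂ) ≠ 0 := by exact_mod_cast hz.ne'
  have hexp (u v : ℂ) (hu : v = u + ((log (Gamma (z / τ)) + log z : ℝ) : ℂ)) :
      Complex.exp v = Complex.exp u * ((Gamma (z / τ) : ℂ) * (z : ℂ)) := by
    rw [hu, Complex.exp_add, ← Complex.ofReal_exp, exp_add,
      exp_log (Gamma_pos_of_pos (div_pos hz hτ)), exp_log hz, Complex.ofReal_mul]
  have hz1 : (z : ℂ) + 1 = ((z + 1 : ℝ) : ℂ) := by push_cast; rfl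
  rw [hz1, doubleGamma_ofReal hτ (by linarith), doubleGamma_ofReal hτ hz, hK z hz]
  generalize ∑' n : ℕ, logGammaTaylorRemainder ((n + 1 : ℕ) * τ) z = S
  rw [doubleGammaBTilde_eq hτ hL, Gamma_add_one hz.ne', mul_assoc, ← Complex.exp_add,
    mul_assoc (1 / _), ← Complex.exp_add, hexp (doubleGammaATilde τ / τ + ((-(L / 2) - K : ℝ) : ℂ) +
      (doubleGammaATilde τ * (z / τ) + ((-(τ ^ 2 * L) : ℝ) : ℂ) * ((z : ℂ) ^ 2 / (2 * (τ : ℂ) ^ 2)) + ((-S : ℝ) : ℂ))),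
    Complex.exp_add (doubleGammaATilde τ / τ + _)]
  · push_cast
    field_simp
  · push_cast
    field_simp
    ring

theorem exists_gPochhammer_eq {τ : ℝ} (hτ : 0 < τ) :
    ∃ c : ℂ, c ≠ 0 ∧ ∀ a : ℝ, 0 < a → ∀ n : ℕ,
      gPochhammer (a : ℂ) τ n = c ^ n * ∏ i ∈ Finset.range n, (Gamma ((a + i) / τ) : ℂ) := by
  obtain ⟨c, hc, h⟩ := exists_doubleGamma_add_one hτ
  refine ⟨c, hc, fun a ha n => ?_⟩
  rw [gPochhammer, div_eq_iff (doubleGamma_ofReal_ne_zero hτ ha)]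
  induction n with
  | zero => simp
  | succ n ih =>
    have hn := h (a + n) (by positivity)
    push_cast at hn ⊢
    rw [← add_assoc, hn, ih, Finset.prod_range_succ]
    ring

/-- The quotient of two `G`-Pochhammer symbols is a product of quotients of gamma values. -/
theorem gPochhammer_div_gPochhammer {τ a b : ℝ} (hτ : 0 < τ) (ha : 0 < a) (hb : 0 < b) (n : ℕ) :
    gPochhammer (a : ℂ) τ n / gPochhammer (b : ℂ) τ n =
      ((∏ i ∈ Finset.range n, Gamma ((a + i) / τ) / Gamma ((b + i) / τ) : ℝ) : ℂ) := by
  obtain ⟨c, hc, h⟩ := exists_gPochhammer_eq hτ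
  rw [h a ha, h b hb, mul_div_mul_left _ _ (pow_ne_zero n hc)]
  push_cast
  rw [Finset.prod_div_distrib]

end Real

/-! ### Convergence of the Kilbas–Saigo series -/

namespace Real

/-- `Γ(y) / Γ(y + α) → 0` as `y → ∞`, for `α > 0`. -/
theorem tendsto_Gamma_div_Gamma_add {α : ℝ} (hα : 0 < α) :
    Tendsto (fun y => Gamma y / Gamma (y + α)) atTop (𝓝 0) := by
  -- Convexity gives `log Γ(y + α) - log Γ(y) ≥ α ψ(y)`, and `ψ → ∞`.
  have h : Tendsto (fun y => exp (-(α * realDigamma y))) atTop (𝓝 0) :=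
    tendsto_exp_neg_atTop_nhds_zero.comp (tendsto_realDigamma_atTop.const_mul_atTop hα)
  refine tendsto_of_tendsto_of_tendsto_of_le_of_le' tendsto_const_nhds h ?_ ?_
  · filter_upwards [eventually_gt_atTop 0] with y hy
    exact div_nonneg (Gamma_pos_of_pos hy).le (Gamma_pos_of_pos (by positivity)).le
  · filter_upwards [eventually_gt_atTop 0] with y hy
    have hyα : 0 < y + α := by positivity
    have hs := convexOn_log_Gamma.le_slope_of_hasDerivAt (x := y) (y := y + α) hy hyα
      (by linarith) (hasDerivAt_log_Gamma hy)
    rw [slope_def_field, add_sub_cancel_left, le_div_iff₀ hα] at hs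
    simp only [Function.comp_apply] at hs
    rw [← exp_log (Gamma_pos_of_pos hy), ← exp_log (Gamma_pos_of_pos hyα), ← exp_sub]
    gcongr
    linarith

end Real

theorem summable_kilbasSaigo {α m l : ℝ} (hα : 0 < α) (hm : 0 < m) (hl : -1 / α < l) (z : ℂ) :
    Summable fun k : ℕ => (kilbasSaigoCoeff α m l k : ℂ) * z ^ k := by
  rw [div_lt_iff₀ hα] at hl
  have hpos (j : ℕ) : 0 < α * (j * m + l) + 1 := by
    have : 0 ≤ α * (j * m) := by positivity
    nlinarith
  have hlim : Tendsto (fun k : ℕ => α * (k * m + l) + 1) atTop atTop :=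
    tendsto_atTop_add_const_right _ _ ((tendsto_atTop_add_const_right _ _
      (Real.tendsto_natCast_mul_atTop hm)).const_mul_atTop hα)
  have hratio : Tendsto (fun k : ℕ => Real.Gamma (α * (k * m + l) + 1) /
      Real.Gamma (α * (k * m + l + 1) + 1)) atTop (𝓝 0) := by
    refine ((Real.tendsto_Gamma_div_Gamma_add hα).comp hlim).congr fun k => ?_
    simp only [Function.comp_apply]
    congr 2
    ring
  have hsmall := (hratio.mul_const ‖z‖).eventually_le_const
    (by simp : (0 : ℝ) * ‖z‖ < 1 / 2)
  refine summable_of_ratio_norm_eventually_le (r := 1 / 2) (by norm_num) ?_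
  filter_upwards [hsmall] with k hk
  have hden : 0 < α * (k * m + l + 1) + 1 := by linarith [hpos k]
  have hq : 0 ≤ Real.Gamma (α * (k * m + l) + 1) / Real.Gamma (α * (k * m + l + 1) + 1) :=
    div_nonneg (Real.Gamma_pos_of_pos (hpos k)).le (Real.Gamma_pos_of_pos hden).le
  rw [kilbasSaigoCoeff, Finset.prod_range_succ, ← kilbasSaigoCoeff, pow_succ, Complex.ofReal_mul,
    mul_mul_mul_comm, norm_mul, norm_mul (Complex.ofReal _) z, Complex.norm_real,
    Real.norm_of_nonneg hq, mul_comm]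
  gcongr

/-! ### Identification of the coefficients -/

theorem kilbasSaigoCoeff_eq_gPochhammer {α m l : ℝ} (hα : 0 < α) (hm : 0 < m) (hl : -1 / α < l)
    (k : ℕ) :
    gPochhammer (((α * l + 1) / (α * m) : ℝ) : ℂ) (1 / (α * m)) k /
      gPochhammer (((α * (l + 1) + 1) / (α * m) : ℝ) : ℂ) (1 / (α * m)) k =
    (kilbasSaigoCoeff α m l k : ℂ) := by
  rw [div_lt_iff₀ hα] at hl
  have h1 : 0 < α * l + 1 := by linarith
  have h2 : 0 < α * (l + 1) + 1 := by linarith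
  rw [Real.gPochhammer_div_gPochhammer (by positivity) (by positivity) (by positivity),
    kilbasSaigoCoeff]
  congr 1
  refine Finset.prod_congr rfl fun i _ => ?_
  congr 2
  all_goals
    field_simp
    ring

theorem ruleOneCoeff_eq_prod_range (N j : ℕ) (α : ℝ) (m : ℕ) :
    ruleOneCoeff N j α m = ∏ i ∈ Finset.range m,
      Real.Gamma (1 + ((i : ℝ) + 1) * N + j - α) / Real.Gamma (1 + ((i : ℝ) + 1) * N + j) := by
  induction m with
  | zero => simp [ruleOneCoeff]
  | succ m ih =>
    rw [ruleOneCoeff, Finset.prod_Icc_succ_top (by omega), ← ruleOneCoeff, ih,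
      Finset.prod_range_succ]
    push_cast
    rfl

/-- The Rule I coefficients are Kilbas–Saigo coefficients. -/
theorem ruleOneCoeff_eq_kilbasSaigoCoeff (N j : ℕ) {α : ℝ} (hα : 0 < α) (m : ℕ) :
    ruleOneCoeff N j α m = kilbasSaigoCoeff α (N / α) ((N - α + j) / α) m := by
  rw [ruleOneCoeff_eq_prod_range, kilbasSaigoCoeff]
  refine Finset.prod_congr rfl fun i _ => ?_
  congr 2
  all_goals
    field_simp
    ring

/-- With `τ = 1 / N`, division by `τ` sends the shifted parameters to `1 + (i + 1) N + j - α` and `1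
+ (i + 1) N + j`; `α ≤ N` keeps the upper parameter positive. -/
theorem ruleOneCoeff_eq_gPochhammer {N j : ℕ} {α : ℝ} (hN : 1 ≤ N) (hα : α ≤ N) (m : ℕ) :
    (ruleOneCoeff N j α m : ℂ) =
      gPochhammer ((1 + (1 + j - α) * (1 / N) : ℝ) : ℂ) (1 / N) m /
        gPochhammer ((1 + (1 + j) * (1 / N) : ℝ) : ℂ) (1 / N) m := by
  have hN0 : (0 : ℝ) < N := by exact_mod_cast hN
  have h1 : 0 < 1 + (1 + j - α) * (1 / (N : ℝ)) := by
    have h : 1 + (1 + j - α) * (1 / (N : ℝ)) = (N - α + 1 + j) / N := by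
      field_simp
      ring
    have : 0 ≤ N - α := sub_nonneg.mpr hα
    rw [h]
    positivity
  rw [Real.gPochhammer_div_gPochhammer (by positivity) h1 (by positivity),
    ruleOneCoeff_eq_prod_range]
  congr 1
  refine Finset.prod_congr rfl fun i _ => ?_
  congr 2
  all_goals
    field_simp
    ring

theorem ruleOnePhi_term_eq (N j : ℕ) (α : ℝ) (x : ℂ) (m : ℕ) :
    (-1) ^ m * (ruleOneCoeff N j α m : ℂ) * x ^ (m * N + j) =
      x ^ j * ((ruleOneCoeff N j α m : ℂ) * (-x ^ N) ^ m) := by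
  rw [neg_pow (x ^ N), ← pow_mul, mul_comm N m, pow_add]
  ring

theorem mainTheorem2 :
    -- the Rule I coefficients and the functions `φ^N_{j,α}`
    (∀ (N j : ℕ) (α τ : ℝ), 1 ≤ N → (N : ℝ) - 1 < α → α ≤ N → j < N → τ = 1 / N →
      (∀ m : ℕ, (ruleOneCoeff N j α m : ℂ) =
        gPochhammer ((1 + (1 + j - α) * τ : ℝ) : ℂ) τ m /
          gPochhammer ((1 + (1 + j) * τ : ℝ) : ℂ) τ m) ∧
      (∀ ω t : ℂ,
        Summable (fun m : ℕ => (-1) ^ m * (ruleOneCoeff N j α m : ℂ) * (ω * t) ^ (m * N + j)) ∧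
        (∃ S : ℂ,
          HasSum (fun m : ℕ =>
            gPochhammer ((1 + (1 + j - α) * τ : ℝ) : ℂ) τ m /
              gPochhammer ((1 + (1 + j) * τ : ℝ) : ℂ) τ m * (-(ω * t) ^ N) ^ m) S ∧
          ruleOnePhi N j α (ω * t) = (ω * t) ^ j * S) ∧
        ruleOnePhi N j α (ω * t) =
          (ω * t) ^ j * kilbasSaigo α (N / α) ((N - α + j) / α) (-(ω * t) ^ N))) ∧
    -- the Kilbas–Saigo function through the `G`-Pochhammer symbol
    (∀ α m l : ℝ, 0 < α → 0 < m → -1 / α < l → ∀ z : ℂ,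
      Summable (fun k : ℕ => (kilbasSaigoCoeff α m l k : ℂ) * z ^ k) ∧
      HasSum (fun k : ℕ =>
        gPochhammer (((α * l + 1) / (α * m) : ℝ) : ℂ) (1 / (α * m)) k /
          gPochhammer (((α * (l + 1) + 1) / (α * m) : ℝ) : ℂ) (1 / (α * m)) k * z ^ k)
        (kilbasSaigo α m l z)) := by
  refine ⟨?_, fun α m l hα hm hl z => ?_⟩
  · rintro N j α τ hN hα hαN - rfl
    have hN' : (1 : ℝ) ≤ N := by exact_mod_cast hN
    have hα0 : 0 < α := by linarith
    have hl : -1 / α < (N - α + j) / α := by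
      have : (0 : ℝ) ≤ j := j.cast_nonneg
      gcongr
      linarith
    refine ⟨ruleOneCoeff_eq_gPochhammer hN hαN, fun ω t => ?_⟩
    have hsum := summable_kilbasSaigo hα0 (div_pos (by linarith : (0 : ℝ) < N) hα0) hl (-(ω * t) ^ N)
    have hphi : ruleOnePhi N j α (ω * t) =
        (ω * t) ^ j * kilbasSaigo α (N / α) ((N - α + j) / α) (-(ω * t) ^ N) := by
      rw [ruleOnePhi, kilbasSaigo, ← tsum_mul_left]
      refine tsum_congr fun m => ?_
      rw [ruleOnePhi_term_eq, ruleOneCoeff_eq_kilbasSaigoCoeff N j hα0]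
    refine ⟨(hsum.mul_left ((ω * t) ^ j)).congr fun m => ?_, ⟨_, ?_, hphi⟩, hphi⟩
    · rw [ruleOnePhi_term_eq, ruleOneCoeff_eq_kilbasSaigoCoeff N j hα0]
    · simp_rw [← ruleOneCoeff_eq_gPochhammer hN hαN, ruleOneCoeff_eq_kilbasSaigoCoeff N j hα0]
      exact hsum.hasSum
  · have hsum := summable_kilbasSaigo hα hm hl z
    refine ⟨hsum, ?_⟩
    simp_rw [kilbasSaigoCoeff_eq_gPochhammer hα hm hl]
    exact hsum.hasSum
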